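/- Let $D\subset\mathbb R^3$ be a bounded domain that is star-shaped with respect to the origin (no regularity of $\partial D$ is required). Let $\lambda>0$ and let $(\Phi,\mathcal R)=(\{z_j\},\{r_j\})$ be a marked Poisson point process of intensity $\lambda$: $\Phi=\{z_j\}$ is a homogeneous Poisson point process on $\mathbb R^3$ with intensity $\lambda$, and the marks $r_j\ge 0$ are independent and identically distributed random variables, independent of the points, with $\mathbb E(r_j^3)<\infty$. For $\varepsilon>0$ put $$\Phi^\varepsilon(D)=\{z\in\Phi:\ \varepsilon z\in D,\ \operatorname{dist}(\varepsilon z,\partial D)>\varepsilon\}.$$ Let $\alpha>3$, $\delta=(\alpha-3)/3$, $\kappa\in(\max(1,\delta),\alpha-2)$, $\tau\ge 1$ and $N=8(2+\lceil 1/\delta\rceil)$. Write $B_\rho(x)$ for the closed Euclidean ball and $\operatorname{dist}_\infty$ for the distance in the maximum norm. Then there is an almost surely positive random variable $\varepsilon_0$ such that for every $0<\varepsilon\le\varepsilon_0$ the following hold. 1. $\tau\varepsilon^\alpha r_i\le\varepsilon^{1+\kappa}$ for all $z_i\in\Phi^\varepsilon(D)$, and $B_{\tau\varepsilon^{1+\kappa}}(\varepsilon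 z_i)\cap B_{\tau\varepsilon^{1+\kappa}}(\varepsilon z_j)=\emptyset$ for all $z_i\ne z_j$ in $\Phi^\varepsilon(D)$. 2. There are finitely many open axis-parallel boxes $I_i^\varepsilon\subset D$ such that (a) $B_{\varepsilon^{1+\kappa}}(\varepsilon z)\subset\bigcup_i I_i^\varepsilon$ for every $z\in\Phi^\varepsilon(D)$; (b) every $I_i^\varepsilon$ contains at most $N$ points of $\varepsilon\Phi^\varepsilon(D)$; (c) if $z\in\Phi^\varepsilon(D)$ and $\varepsilon z\in I_i^\varepsilon$, then $\operatorname{dist}(B_{\varepsilon^{1+\kappa}}(\varepsilon z),\partial I_i^\varepsilon)\ge\frac{1}{16N}\varepsilon^{1+\delta}$; (d) $\operatorname{dist}_\infty(I_i^\varepsilon,I_j^\varepsilon)\ge\frac{1}{4N}\varepsilon^{1+\delta}$ for $i\ne j$; (e) every side of $I_i^\varepsilon$ has length at least $\frac{1}{2N}\varepsilon^{1+\delta}$ and at most $\varepsilon^{1+\delta}$. -/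

import Mathlib

open MeasureTheory ProbabilityTheory

/-- Three-dimensional Euclidean space. -/
abbrev E3 : Type := EuclideanSpace ℝ (Fin 3)

/-- The random point set `Φ(ω) = {z_j(ω)}` enumerated by the sequence `z`. -/
def pointSet {Ω : Type*} (z : ℕ → Ω → E3) (ω : Ω) : Set E3 :=
  Set.range fun j => z j ω

/-- `N(S) = #(S ∩ Φ)`, the (possibly infinite) number of points in `S`. -/
noncomputable def pointCount {Ω : Type*} (z : ℕ → Ω → E3) (S : Set E3) (ω : Ω) : ℕ∞ :=
  (S ∩ pointSet z ω).encard

/-- The points `z_j`, enumerated without repetition, form a homogeneous Poisson point process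
on `ℝ³` of intensity `lam > 0`. (Such a process has almost surely infinitely many points, so that
it can be enumerated by `ℕ`.) -/
structure IsPoissonPointProcess {Ω : Type*} [MeasurableSpace Ω] (μ : Measure Ω)
    (lam : ℝ) (z : ℕ → Ω → E3) : Prop where
  measurable_point : ∀ j, Measurable (z j)
  ae_injective : ∀ᵐ ω ∂μ, Function.Injective fun j => z j ω
  indep_count : ∀ (n : ℕ) (S : Fin n → Set E3), (∀ i, MeasurableSet (S i)) →
    Pairwise (fun i j => Disjoint (S i) (S j)) → iIndepFun (fun i => pointCount z (S i)) μ
  count_law : ∀ S : Set E3, MeasurableSet S → volume S ≠ ⊤ → ∀ k : ℕ,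
    μ.real {ω | pointCount z S ω = k} =
      (lam * volume.real S) ^ k * Real.exp (-(lam * volume.real S)) / (k.factorial : ℝ)

/-- `(Φ, R) = ({z_j}, {r_j})` is a marked Poisson point process of intensity `lam`: the marks
`r_j ≥ 0` are independent, identically distributed, and independent of the points. -/
structure IsMarkedPoissonPointProcess {Ω : Type*} [MeasurableSpace Ω] (μ : Measure Ω)
    (lam : ℝ) (z : ℕ → Ω → E3) (r : ℕ → Ω → ℝ) : Prop where
  points : IsPoissonPointProcess μ lam z
  measurable_mark : ∀ j, Measurable (r j)
  mark_nonneg : ∀ j, ∀ᵐ ω ∂μ, 0 ≤ r j ω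
  mark_iIndep : iIndepFun r μ
  mark_identDistrib : ∀ j, IdentDistrib (r j) (r 0) μ μ
  indep_points_marks : IndepFun (fun ω j => z j ω) (fun ω j => r j ω) μ

/-- `Φ^ε(D) = {z ∈ Φ ∩ ε⁻¹ D : dist(ε z, ∂D) > ε}`, for the point set `Φ`. -/
def innerPoints (Φ : Set E3) (D : Set E3) (ε : ℝ) : Set E3 :=
  {p | p ∈ Φ ∧ ε • p ∈ D ∧ ε < Metric.infDist (ε • p) (frontier D)}

/-- The open axis-parallel box `∏ᵢ (aᵢ, bᵢ)`. -/
def openBox (a b : Fin 3 → ℝ) : Set E3 :=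
  {x | ∀ i, a i < x i ∧ x i < b i}

/-- The distance of two points of `ℝ³` in the maximum norm. -/
noncomputable def distSup (x y : E3) : ℝ :=
  dist (WithLp.ofLp x) (WithLp.ofLp y)

/-- `N(δ) = 8 (2 + ⌈1/δ⌉)`. -/
noncomputable def clusterBound (δ : ℝ) : ℕ :=
  8 * (2 + ⌈1 / δ⌉₊)

/-! Boundedness of `D` puts the relevant points in a cube of size `R / ε`, so everything reduces to
events about that cube, handled by Borel–Cantelli over `ε ∈ (2⁻ᵏ⁻¹, 2⁻ᵏ]`. Each bad event over such
a range lies in a single event at scale `k`, of geometrically decaying probability.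

Marks: the mean number of points is of order `ε⁻³`, and Markov's inequality for `r³` bounds the
chance of a mark above `ε⁻ˢ / τ` by order `ε³ˢ`; this is summable for `s = α - 1 - κ > 1`. Clusters
(`hasThreshold_cluster`): a grid of order `ε^(-3(1+γ))` cubes of side of order `ε^γ`, each holding
`n + 1` points with probability of order `ε^(3γ(n+1))`, gives `ε^(3(γn-1))`. Taking `γ = κ`, `n = 1`
separates the balls; taking `γ = δ`, `n = N` excludes large clusters.

The boxes are then deterministic (`IsClustering.merge`, `exists_separated_boxes`). With `h = ε^(1+δ)
/ (4N)`, start from singletons and merge any two clusters not `3h` apart in some coordinate. The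
spread stays below `3(card - 1)h`, so a union of two clusters still has spread at most `6Nh` and
hence at most `N` points. Bounding boxes of the final clusters, enlarged by `h`, have gaps at least
`h` and sides at most `4Nh`. -/

/-- `Q ω ε` holds for all `ε` below an almost surely positive random threshold. -/
def HasThreshold {Ω : Type*} [MeasurableSpace Ω] (μ : Measure Ω) (Q : Ω → ℝ → Prop) : Prop :=
  ∃ ε₀ : Ω → ℝ, Measurable ε₀ ∧ (∀ᵐ ω ∂μ, 0 < ε₀ ω) ∧ ∀ ω, ∀ ε : ℝ, 0 < ε → ε ≤ ε₀ ω → Q ω ε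

/-! ### Almost sure thresholds and Borel–Cantelli. -/

namespace HasThreshold

variable {Ω : Type*} [MeasurableSpace Ω] {μ : Measure Ω} {Q Q' : Ω → ℝ → Prop}

theorem and (h : HasThreshold μ Q) (h' : HasThreshold μ Q') :
    HasThreshold μ fun ω ε => Q ω ε ∧ Q' ω ε := by
  obtain ⟨e, em, ep, eQ⟩ := h
  obtain ⟨e', em', ep', eQ'⟩ := h'
  refine ⟨fun ω => min (e ω) (e' ω), em.min em', ?_, fun ω ε h0 hε => ?_⟩
  · filter_upwards [ep, ep'] with ω h1 h2 using lt_min h1 h2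
  · exact ⟨eQ ω ε h0 (hε.trans (min_le_left _ _)), eQ' ω ε h0 (hε.trans (min_le_right _ _))⟩

theorem mono (h : HasThreshold μ Q) (hQ : ∀ ω ε, 0 < ε → Q ω ε → Q' ω ε) : HasThreshold μ Q' := by
  obtain ⟨e, em, ep, eQ⟩ := h
  exact ⟨e, em, ep, fun ω ε h0 hε => hQ ω ε h0 (eQ ω ε h0 hε)⟩

/-- A deterministic property of all small `ε`. -/
theorem of_eventually {q : ℝ → Prop} (h : ∀ᶠ ε in nhdsWithin 0 (Set.Ioi 0), q ε) :
    HasThreshold μ fun _ ε => q ε := by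
  obtain ⟨e, he, hq⟩ := mem_nhdsGT_iff_exists_Ioc_subset.1 h
  exact ⟨fun _ => e, measurable_const, .of_forall fun _ => he, fun _ ε h0 hε => hq ⟨h0, hε⟩⟩

/-- Borel–Cantelli along dyadic scales; the exceptional sets need not be measurable. -/
theorem of_tsum_ne_top
    (h : ∑' k : ℕ, μ {ω | ∃ ε : ℝ, (1 / 2 : ℝ) ^ (k + 1) < ε ∧ ε ≤ (1 / 2 : ℝ) ^ k ∧ ¬ Q ω ε} ≠ ⊤) :
    HasThreshold μ Q := by
  classical
  set B : ℕ → Set Ω :=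
    fun k => {ω | ∃ ε : ℝ, (1 / 2 : ℝ) ^ (k + 1) < ε ∧ ε ≤ (1 / 2 : ℝ) ^ k ∧ ¬ Q ω ε}
  have hBm : ∀ k, MeasurableSet (toMeasurable μ (B k)) := fun k => measurableSet_toMeasurable _ _
  have hBC : ∀ᵐ ω ∂μ, ∀ᶠ k in Filter.atTop, ω ∉ toMeasurable μ (B k) := by
    apply ae_eventually_notMem
    simpa only [measure_toMeasurable] using h
  -- `e n` is `2⁻ⁿ` if no bad event occurs from scale `n` on, and `0` otherwise; measurable hulls
  -- keep it measurable.
  set e : ℕ → Ω → ℝ := fun n =>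
    (⋂ k ≥ n, (toMeasurable μ (B k))ᶜ).indicator fun _ => (1 / 2 : ℝ) ^ n
  have hGm : ∀ n, MeasurableSet (⋂ k ≥ n, (toMeasurable μ (B k))ᶜ) := fun n =>
    MeasurableSet.iInter fun k => MeasurableSet.iInter fun _ => (hBm k).compl
  have he0 : ∀ n ω, 0 ≤ e n ω := fun n ω => Set.indicator_nonneg (fun _ _ => by positivity) _
  have hle : ∀ n ω, e n ω ≤ 1 := fun n ω =>
    Set.indicator_apply_le' (fun _ => pow_le_one₀ (by norm_num) (by norm_num)) fun _ => zero_le_one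
  have hbdd : ∀ ω, BddAbove (Set.range fun n => e n ω) := fun ω =>
    ⟨1, by rintro _ ⟨n, rfl⟩; exact hle n ω⟩
  -- Halving turns `ε ≤ ε₀` into a strict inequality below the supremum, so that some `e n` exceeds
  -- `ε`.
  refine ⟨fun ω => (⨆ n, e n ω) / 2,
    (Measurable.iSup fun n => measurable_const.indicator (hGm n)).div_const 2, ?_, ?_⟩
  · filter_upwards [hBC] with ω hω
    obtain ⟨n, hn⟩ := Filter.eventually_atTop.1 hω
    have : e n ω = (1 / 2 : ℝ) ^ n := Set.indicator_of_mem (by simpa using hn) _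
    have h1 : 0 < e n ω := by rw [this]; positivity
    have := h1.trans_le (le_ciSup (hbdd ω) n)
    positivity
  · intro ω ε h0 hε
    have hlt : ε < ⨆ n, e n ω := by linarith
    obtain ⟨n, hn⟩ := exists_lt_of_lt_ciSup hlt
    have hmem : ω ∈ ⋂ k ≥ n, (toMeasurable μ (B k))ᶜ := by
      by_contra hcon
      have : e n ω = 0 := Set.indicator_of_notMem hcon _
      linarith
    have hen : e n ω = (1 / 2 : ℝ) ^ n := Set.indicator_of_mem hmem _
    have hε1 : ε ≤ 1 := hn.le.trans (hle n ω)
    obtain ⟨k, hk1, hk2⟩ := exists_nat_pow_near_of_lt_one h0 hε1 (y := (1 / 2 : ℝ))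
      (by norm_num) (by norm_num)
    have hnk : n ≤ k := by
      by_contra hcon
      have : (1 / 2 : ℝ) ^ n ≤ (1 / 2 : ℝ) ^ (k + 1) :=
        pow_le_pow_of_le_one (by norm_num) (by norm_num) (by omega)
      linarith [hen]
    by_contra hQ
    simp only [Set.mem_iInter, Set.mem_compl_iff] at hmem
    exact hmem k hnk (subset_toMeasurable _ _ ⟨ε, hk1, hk2, hQ⟩)

end HasThreshold

/-! ### Volumes of cubes and counting estimates for the Poisson process. -/

theorem volume_box_eq (a : Fin 3 → ℝ) {s : ℝ} (hs : 0 ≤ s) :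
    MeasurableSet {x : E3 | ∀ i, x i ∈ Set.Icc (a i) (a i + s)} ∧
    volume {x : E3 | ∀ i, x i ∈ Set.Icc (a i) (a i + s)} = ENNReal.ofReal (s ^ 3) := by
  have hS : {x : E3 | ∀ i, x i ∈ Set.Icc (a i) (a i + s)} =
      (WithLp.ofLp : E3 → Fin 3 → ℝ) ⁻¹' Set.Icc a (fun i => a i + s) := by
    ext x
    simp only [Set.mem_ofPred_eq, Set.mem_preimage, Set.mem_Icc, Pi.le_def, forall_and]
  have hp := PiLp.volume_preserving_ofLp (Fin 3)
  rw [hS]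
  refine ⟨hp.measurable measurableSet_Icc, ?_⟩
  rw [hp.measure_preimage measurableSet_Icc.nullMeasurableSet, Real.volume_Icc_pi]
  simp [ENNReal.ofReal_pow hs]

namespace IsPoissonPointProcess

variable {Ω : Type*} [MeasurableSpace Ω] {μ : Measure Ω} {lam : ℝ} {z : ℕ → Ω → E3}

/-- The number of indices `j` with `z j ω ∈ S`, which is measurable in `ω`. -/
noncomputable def indexCount (z : ℕ → Ω → E3) (S : Set E3) (ω : Ω) : ENNReal :=
  ∑' j, S.indicator 1 (z j ω)

theorem measurable_indexCount (h : IsPoissonPointProcess μ lam z) {S : Set E3}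
    (hS : MeasurableSet S) : Measurable (indexCount z S) :=
  Measurable.tsum fun j => (measurable_one.indicator hS).comp (h.measurable_point j)

theorem pointCount_eq_indexCount (h : IsPoissonPointProcess μ lam z) (S : Set E3) :
    ∀ᵐ ω ∂μ, (pointCount z S ω : ENNReal) = indexCount z S ω := by
  filter_upwards [h.ae_injective] with ω hω
  have h1 : pointCount z S ω = {j | z j ω ∈ S}.encard := by
    rw [pointCount, pointSet, ← hω.encard_image]
    congr 1
    ext x
    simp only [Set.mem_inter_iff, Set.mem_range, Set.mem_image, Set.mem_ofPred_eq]
    constructor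
    · rintro ⟨hx, j, rfl⟩; exact ⟨j, hx, rfl⟩
    · rintro ⟨j, hx, rfl⟩; exact ⟨hx, j, rfl⟩
  rw [h1, ← ENNReal.tsum_set_one, indexCount]
  exact tsum_subtype {j | z j ω ∈ S} fun _ => (1 : ENNReal)

variable [IsProbabilityMeasure μ]

theorem measure_indexCount_eq (h : IsPoissonPointProcess μ lam z) {S : Set E3}
    (hS : MeasurableSet S) (hvol : volume S ≠ ⊤) (k : ℕ) :
    μ {ω | indexCount z S ω = k} = ENNReal.ofReal
      ((lam * volume.real S) ^ k * Real.exp (-(lam * volume.real S)) / (k.factorial : ℝ)) := by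
  rw [← h.count_law S hS hvol k, ofReal_measureReal]
  apply measure_congr
  filter_upwards [h.pointCount_eq_indexCount S] with ω hω
  apply propext
  change indexCount z S ω = k ↔ pointCount z S ω = k
  rw [← hω]
  norm_cast

theorem hasSum_poisson_weights (Λ : ℝ) :
    HasSum (fun k : ℕ => Λ ^ k * Real.exp (-Λ) / (k.factorial : ℝ)) 1 := by
  have h := (NormedSpace.expSeries_div_hasSum_exp Λ).mul_right (Real.exp (-Λ))
  rw [← Real.exp_eq_exp_ℝ, ← Real.exp_add, add_neg_cancel, Real.exp_zero] at h
  simpa only [div_mul_eq_mul_div] using h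

/-- Almost surely a set of finite volume contains only finitely many points. -/
theorem ae_exists_indexCount_eq (h : IsPoissonPointProcess μ lam z) (hlam : 0 < lam) {S : Set E3}
    (hS : MeasurableSet S) (hvol : volume S ≠ ⊤) :
    ∀ᵐ ω ∂μ, ∃ k : ℕ, indexCount z S ω = k := by
  have hm : ∀ k : ℕ, MeasurableSet {ω | indexCount z S ω = k} := fun k =>
    h.measurable_indexCount hS (measurableSet_singleton _)
  have hU : {ω | ∃ k : ℕ, indexCount z S ω = k} = ⋃ k : ℕ, {ω | indexCount z S ω = k} := by
    ext; simp
  have hone : μ {ω | ∃ k : ℕ, indexCount z S ω = k} = 1 := by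
    rw [hU, measure_iUnion _ hm]
    · simp_rw [h.measure_indexCount_eq hS hvol]
      have hs := hasSum_poisson_weights (lam * volume.real S)
      rw [← ENNReal.ofReal_tsum_of_nonneg _ hs.summable, hs.tsum_eq, ENNReal.ofReal_one]
      intro k
      positivity
    · intro i j hij
      refine Set.disjoint_left.2 fun ω hi hj => hij ?_
      have : (i : ENNReal) = j := (Eq.symm hi).trans hj
      exact_mod_cast this
  exact (mem_ae_iff_prob_eq_one (hU ▸ MeasurableSet.iUnion hm)).2 hone

theorem ae_pointCount_ne_top (h : IsPoissonPointProcess μ lam z) (hlam : 0 < lam) {S : Set E3}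
    (hS : MeasurableSet S) (hvol : volume S ≠ ⊤) : ∀ᵐ ω ∂μ, pointCount z S ω ≠ ⊤ := by
  filter_upwards [h.ae_exists_indexCount_eq hlam hS hvol, h.pointCount_eq_indexCount S]
    with ω ⟨k, hk⟩ h2 htop
  rw [hk, htop] at h2
  simp at h2

/-- Since `(k + m)! ≥ k!`, the Poisson tail from `m` on is at most `Λ ^ m` times the total mass `1`.
-/
theorem measure_le_pointCount (h : IsPoissonPointProcess μ lam z) (hlam : 0 < lam) {S : Set E3}
    (hS : MeasurableSet S) (hvol : volume S ≠ ⊤) (m : ℕ) :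
    μ {ω | (m : ℕ∞) ≤ pointCount z S ω} ≤ ENNReal.ofReal ((lam * volume.real S) ^ m) := by
  set Λ := lam * volume.real S with hΛ
  have hΛ0 : 0 ≤ Λ := by positivity
  have hle : μ {ω | (m : ℕ∞) ≤ pointCount z S ω} ≤
      μ (⋃ j : ℕ, {ω | indexCount z S ω = (j + m : ℕ)}) := by
    apply measure_mono_ae
    filter_upwards [h.ae_exists_indexCount_eq hlam hS hvol, h.pointCount_eq_indexCount S]
      with ω ⟨k, hk⟩ h2 h3
    change (m : ℕ∞) ≤ pointCount z S ω at h3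
    rw [hk] at h2
    have h4 : pointCount z S ω = k := by exact_mod_cast h2
    rw [h4] at h3
    have h5 : m ≤ k := by exact_mod_cast h3
    refine Set.mem_iUnion.2 ⟨k - m, ?_⟩
    change indexCount z S ω = _
    rw [hk, Nat.sub_add_cancel h5]
  refine hle.trans ((measure_iUnion_le _).trans ?_)
  simp_rw [h.measure_indexCount_eq hS hvol, ← hΛ]
  have hs := (hasSum_poisson_weights Λ).mul_left (Λ ^ m)
  rw [mul_one] at hs
  rw [← hs.tsum_eq, ENNReal.ofReal_tsum_of_nonneg (fun k => by positivity) hs.summable]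
  refine ENNReal.tsum_le_tsum fun k => ENNReal.ofReal_le_ofReal ?_
  rw [pow_add, mul_comm (Λ ^ k), mul_assoc, mul_div_assoc]
  gcongr
  exact Nat.le_add_right k m

/-- The left side is the mean number of points in `S`, computed from `k w(k) = Λ w(k - 1)` for the
Poisson weights. -/
theorem tsum_measure_mem_le (h : IsPoissonPointProcess μ lam z) (hlam : 0 < lam) {S : Set E3}
    (hS : MeasurableSet S) (hvol : volume S ≠ ⊤) :
    ∑' j, μ {ω | z j ω ∈ S} ≤ ENNReal.ofReal (lam * volume.real S) := by
  set Λ := lam * volume.real S with hΛ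
  have hΛ0 : 0 ≤ Λ := by positivity
  have hm : ∀ k : ℕ, MeasurableSet {ω | indexCount z S ω = k} := fun k =>
    h.measurable_indexCount hS (measurableSet_singleton _)
  have h1 : ∑' j, μ {ω | z j ω ∈ S} = ∫⁻ ω, indexCount z S ω ∂μ := by
    have hmeas : ∀ j, AEMeasurable (fun ω => S.indicator (1 : E3 → ENNReal) (z j ω)) μ := fun j =>
      ((measurable_one.indicator hS).comp (h.measurable_point j)).aemeasurable
    unfold indexCount
    rw [lintegral_tsum hmeas]
    refine tsum_congr fun j => ?_
    exact (lintegral_indicator_one (h.measurable_point j hS)).symm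
  have h2 : ∫⁻ ω, indexCount z S ω ∂μ ≤
      ∫⁻ ω, ∑' k : ℕ, {ω | indexCount z S ω = k}.indicator (fun _ => (k : ENNReal)) ω ∂μ := by
    apply lintegral_mono_ae
    filter_upwards [h.ae_exists_indexCount_eq hlam hS hvol] with ω ⟨k, hk⟩
    refine le_trans ?_ (ENNReal.le_tsum k)
    rw [Set.indicator_of_mem (by exact hk), hk]
  rw [h1]
  refine h2.trans ?_
  rw [lintegral_tsum fun k => (measurable_const.indicator (hm k)).aemeasurable]
  simp_rw [lintegral_indicator_const (hm _), h.measure_indexCount_eq hS hvol, ← hΛ]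
  rw [tsum_eq_zero_add' ENNReal.summable]
  simp only [Nat.cast_zero, zero_mul, zero_add]
  have hs := (hasSum_poisson_weights Λ).mul_left Λ
  rw [mul_one] at hs
  have hsum : ENNReal.ofReal Λ =
      ∑' k : ℕ, ENNReal.ofReal (Λ * (Λ ^ k * Real.exp (-Λ) / (k.factorial : ℝ))) := by
    rw [← ENNReal.ofReal_tsum_of_nonneg (fun k => by positivity) hs.summable, hs.tsum_eq]
  rw [hsum]
  refine ENNReal.tsum_le_tsum fun k => ?_
  rw [← ENNReal.ofReal_natCast, ← ENNReal.ofReal_mul (by positivity)]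
  refine ENNReal.ofReal_le_ofReal (le_of_eq ?_)
  rw [Nat.factorial_succ]
  push_cast
  field_simp
  ring

end IsPoissonPointProcess

/-! ### Clusters, finiteness and marks at dyadic scales. -/

theorem volume_cube_abs_le {ρ : ℝ} (hρ : 0 ≤ ρ) :
    MeasurableSet {x : E3 | ∀ i, |x i| ≤ ρ} ∧
    volume {x : E3 | ∀ i, |x i| ≤ ρ} = ENNReal.ofReal ((2 * ρ) ^ 3) := by
  have h := volume_box_eq (fun _ => -ρ) (s := 2 * ρ) (by positivity)
  have hS : {x : E3 | ∀ i, |x i| ≤ ρ} = {x : E3 | ∀ i, x i ∈ Set.Icc (-ρ) (-ρ + 2 * ρ)} := by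
    ext x
    simp only [Set.mem_ofPred_eq, Set.mem_Icc, abs_le]
    refine forall_congr' fun i => and_congr_right fun _ => ?_
    rw [show -ρ + 2 * ρ = ρ by ring]
  rw [hS]
  exact h

theorem rpow_half_mul_natCast (y : ℝ) (k : ℕ) :
    ((1 / 2 : ℝ) ^ k) ^ y = ((1 / 2 : ℝ) ^ y) ^ k := by
  rw [← Real.rpow_natCast, ← Real.rpow_natCast, ← Real.rpow_mul (by norm_num),
    ← Real.rpow_mul (by norm_num), mul_comm]

theorem ENNReal.tsum_ofReal_geometric_ne_top {C q : ℝ} (hC : 0 ≤ C) (hq0 : 0 ≤ q) (hq : q < 1) :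
    ∑' k : ℕ, ENNReal.ofReal (C * q ^ k) ≠ ⊤ := by
  rw [← ENNReal.ofReal_tsum_of_nonneg (fun k => by positivity)
    ((summable_geometric_of_lt_one hq0 hq).mul_left C)]
  exact ENNReal.ofReal_ne_top

namespace IsPoissonPointProcess

variable {Ω : Type*} [MeasurableSpace Ω] {μ : Measure Ω} [IsProbabilityMeasure μ] {lam : ℝ}
  {z : ℕ → Ω → E3}

/-- The probability of finding `m` points close together in a large cube. -/
theorem measure_exists_cluster_le (h : IsPoissonPointProcess μ lam z) (hlam : 0 < lam) {ρ s : ℝ}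
    (hs : 0 < s) (hsρ : s ≤ ρ) {m : ℕ} (hm : 1 ≤ m) :
    μ {ω | ∃ A ⊆ pointSet z ω, (∀ p ∈ A, ∀ i, |p i| ≤ ρ) ∧
      (∀ p ∈ A, ∀ q ∈ A, ∀ i, |p i - q i| ≤ s) ∧ (m : ℕ∞) ≤ A.encard} ≤
      ENNReal.ofReal ((5 * ρ / s) ^ 3 * (lam * (3 * s) ^ 3) ^ m) := by
  set K : ℕ := ⌈ρ / s⌉₊
  set I : Finset (Fin 3 → ℤ) := Fintype.piFinset fun _ => Finset.Icc (-(K : ℤ)) K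
  -- The grid cell of index `v`, enlarged by `s` on every side: it contains all of `A` as soon as
  -- the cell contains one point of `A`.
  set S : (Fin 3 → ℤ) → Set E3 :=
    fun v => {x : E3 | ∀ i, x i ∈ Set.Icc (v i * s - s) (v i * s - s + 3 * s)}
  have hS : ∀ v, MeasurableSet (S v) ∧ volume (S v) = ENNReal.ofReal ((3 * s) ^ 3) := fun v =>
    volume_box_eq (fun i => v i * s - s) (by positivity)
  have hsub : {ω | ∃ A ⊆ pointSet z ω, (∀ p ∈ A, ∀ i, |p i| ≤ ρ) ∧
      (∀ p ∈ A, ∀ q ∈ A, ∀ i, |p i - q i| ≤ s) ∧ (m : ℕ∞) ≤ A.encard} ⊆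
      ⋃ v ∈ I, {ω | (m : ℕ∞) ≤ pointCount z (S v) ω} := by
    rintro ω ⟨A, hA, hAρ, hAs, hAm⟩
    have hne : A.Nonempty := by
      rw [← Set.encard_pos]
      refine lt_of_lt_of_le ?_ hAm
      exact_mod_cast hm
    obtain ⟨p, hp⟩ := hne
    refine Set.mem_biUnion (x := fun i => ⌊p i / s⌋) ?_ ?_
    · refine Fintype.mem_piFinset.2 fun i => Finset.mem_Icc.2 ?_
      have h1 := abs_le.1 (hAρ p hp i)
      have h2 : ρ / s ≤ K := Nat.le_ceil _
      constructor
      · rw [Int.le_floor]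
        push_cast
        rw [le_div_iff₀ hs]
        rw [div_le_iff₀ hs] at h2
        linarith
      · have h3 : (⌊p i / s⌋ : ℝ) ≤ K :=
          (Int.floor_le _).trans ((div_le_div_of_nonneg_right h1.2 hs.le).trans h2)
        exact_mod_cast h3
    · refine hAm.trans (Set.encard_le_encard fun q hq => ⟨fun i => ?_, hA hq⟩)
      have h1 := abs_le.1 (hAs p hp q hq i)
      have h2 := Int.floor_le (p i / s)
      have h3 := Int.lt_floor_add_one (p i / s)
      rw [le_div_iff₀ hs] at h2
      rw [div_lt_iff₀ hs] at h3
      constructor <;> linarith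
  refine (measure_mono hsub).trans ((measure_biUnion_finset_le _ _).trans ?_)
  have hterm : ∀ v ∈ I, μ {ω | (m : ℕ∞) ≤ pointCount z (S v) ω} ≤
      ENNReal.ofReal ((lam * (3 * s) ^ 3) ^ m) := by
    intro v _
    have := h.measure_le_pointCount hlam (hS v).1 (by rw [(hS v).2]; exact ENNReal.ofReal_ne_top) m
    rwa [Measure.real, (hS v).2, ENNReal.toReal_ofReal (by positivity)] at this
  refine (Finset.sum_le_card_nsmul _ _ _ hterm).trans ?_
  rw [nsmul_eq_mul, ← ENNReal.ofReal_natCast, ← ENNReal.ofReal_mul (by positivity)]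
  refine ENNReal.ofReal_le_ofReal ?_
  gcongr
  have hcard : I.card = (2 * K + 1) ^ 3 := by
    simp only [I, Fintype.card_piFinset, Int.card_Icc, Finset.prod_const, Finset.card_univ,
      Fintype.card_fin]
    congr 1
    omega
  rw [hcard]
  push_cast
  gcongr
  -- The constant `5` comes from `2K + 1 ≤ 2ρ/s + 3 ≤ 5ρ/s`.
  have h1 : (K : ℝ) < ρ / s + 1 := Nat.ceil_lt_add_one (div_nonneg (hs.le.trans hsρ) hs.le)
  have h2 : 1 ≤ ρ / s := (one_le_div hs).2 hsρ
  rw [mul_div_assoc]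
  linarith

/-- Almost surely, at most `n` points of the process in a cube of size `1 / ε` can be
`ε ^ γ`-close to each other, provided that `γ n > 1`. -/
theorem hasThreshold_cluster (h : IsPoissonPointProcess μ lam z) (hlam : 0 < lam) (R : ℝ)
    {c γ : ℝ} (hc : 0 < c) (hγ : 0 < γ) {n : ℕ} (hn : 1 < γ * n) :
    HasThreshold μ fun ω ε => ∀ A ⊆ pointSet z ω, (∀ p ∈ A, ∀ i, |p i| ≤ R / ε) →
      (∀ p ∈ A, ∀ q ∈ A, ∀ i, |p i - q i| ≤ c * ε ^ γ) → A.encard ≤ n := by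
  apply HasThreshold.of_tsum_ne_top
  set b : ℝ := (1 / 2 : ℝ) ^ γ with hb
  have hb0 : 0 < b := by positivity
  have hb1 : b ≤ 1 := Real.rpow_le_one (by norm_num) (by norm_num) hγ.le
  -- The maximum with `c` guarantees `s ≤ ρ` at every scale.
  set T : ℝ := max R c
  have hTc : c ≤ T := le_max_right _ _
  have hT : 0 < T := hc.trans_le hTc
  -- The ratio of the geometric bound: `(2 / b)³` from the number of cells times `b^(3(n+1))` from
  -- each cell. It is below `1` because `γ n > 1`.
  have hq : (2 * b ^ n) ^ 3 < 1 := by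
    have : b ^ n < 1 / 2 := by
      rw [hb, ← Real.rpow_mul_natCast (by norm_num)]
      conv_rhs => rw [← Real.rpow_one (1 / 2 : ℝ)]
      exact Real.rpow_lt_rpow_of_exponent_gt (by norm_num) (by norm_num) hn
    exact pow_lt_one₀ (by positivity) (by linarith) (by norm_num)
  refine ne_top_of_le_ne_top (ENNReal.tsum_ofReal_geometric_ne_top
    (C := (10 * T / c) ^ 3 * (lam * 27 * c ^ 3) ^ (n + 1)) (by positivity) (by positivity) hq)
    (ENNReal.tsum_le_tsum fun k => ?_)
  have hbk : b ^ k ≤ 1 := pow_le_one₀ hb0.le hb1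
  have h2k : (1 : ℝ) ≤ 2 ^ (k + 1) := one_le_pow₀ (by norm_num)
  have hbound := h.measure_exists_cluster_le hlam (ρ := T * 2 ^ (k + 1)) (s := c * b ^ k)
    (by positivity) (by nlinarith) (m := n + 1) (by omega)
  refine (measure_mono ?_).trans (hbound.trans (le_of_eq ?_))
  · rintro ω ⟨ε, hε1, hε2, hQ⟩
    have hε : 0 < ε := lt_trans (by positivity) hε1
    push Not at hQ
    obtain ⟨A, hA, hAρ, hAs, hAn⟩ := hQ
    refine ⟨A, hA, fun p hp i => (hAρ p hp i).trans ?_, fun p hp q hq i =>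
      (hAs p hp q hq i).trans ?_, ?_⟩
    · rw [div_le_iff₀ hε]
      have : 1 ≤ 2 ^ (k + 1) * ε := by
        have h3 : (2 : ℝ) ^ (k + 1) * (1 / 2) ^ (k + 1) = 1 := by
          rw [← mul_pow]; norm_num
        rw [← h3]
        gcongr
      rw [mul_assoc]
      exact (le_max_left R c).trans (le_mul_of_one_le_right hT.le this)
    · rw [hb, ← rpow_half_mul_natCast]
      gcongr
    · rw [Nat.cast_add, Nat.cast_one]
      exact Order.add_one_le_of_lt hAn
  · congr 1
    have e1 : ((2 * b ^ n) ^ 3) ^ k = (2 ^ k) ^ 3 * ((b ^ k) ^ n) ^ 3 := by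
      rw [pow_right_comm, mul_pow]
      ring
    rw [e1, pow_succ (2 : ℝ) k]
    have hx : 0 < b ^ k := by positivity
    generalize b ^ k = x at hx
    field_simp
    ring

/-- The bad event at each scale is null, as a cube of finite volume almost surely holds finitely
many points. The merging of clusters needs this finiteness. -/
theorem hasThreshold_finite (h : IsPoissonPointProcess μ lam z) (hlam : 0 < lam) {R : ℝ}
    (hR : 0 ≤ R) :
    HasThreshold μ fun ω ε => {p ∈ pointSet z ω | ∀ i, |p i| ≤ R / ε}.Finite := by
  apply HasThreshold.of_tsum_ne_top
  suffices hz : ∀ k : ℕ, μ {ω | ∃ ε : ℝ, (1 / 2 : ℝ) ^ (k + 1) < ε ∧ ε ≤ (1 / 2 : ℝ) ^ k ∧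
      ¬ {p ∈ pointSet z ω | ∀ i, |p i| ≤ R / ε}.Finite} = 0 by
    rw [ENNReal.tsum_eq_zero.2 hz]
    exact ENNReal.zero_ne_top
  intro k
  have hv := volume_cube_abs_le (ρ := R * 2 ^ (k + 1)) (by positivity)
  have hae := h.ae_pointCount_ne_top hlam hv.1 (by rw [hv.2]; exact ENNReal.ofReal_ne_top)
  refine measure_mono_null ?_ (ae_iff.1 hae)
  rintro ω ⟨ε, hε1, -, hQ⟩ hne
  have hε : 0 < ε := lt_trans (by positivity) hε1
  refine hQ ((Set.encard_ne_top_iff.1 hne).subset fun p hp => ⟨fun i => (hp.2 i).trans ?_, hp.1⟩)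
  rw [div_eq_mul_inv]
  gcongr
  rw [inv_le_comm₀ hε (by positivity), ← inv_pow]
  norm_num at hε1 ⊢
  exact hε1.le

end IsPoissonPointProcess

/-- Almost surely, the marks of the points in a cube of size `1 / ε` are at most of order
`ε ^ (-s)`, for any `s > 1`. -/
theorem IsMarkedPoissonPointProcess.hasThreshold_marks {Ω : Type*} [MeasurableSpace Ω]
    {μ : Measure Ω} [IsProbabilityMeasure μ] {lam : ℝ} {z : ℕ → Ω → E3} {r : ℕ → Ω → ℝ}
    (h : IsMarkedPoissonPointProcess μ lam z r) (hlam : 0 < lam)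
    (hr3 : Integrable (fun ω => r 0 ω ^ 3) μ) {R τ s : ℝ} (hR : 0 ≤ R) (hτ : 0 < τ) (hs : 1 < s) :
    HasThreshold μ fun ω ε => ∀ j, (∀ i, |z j ω i| ≤ R / ε) → τ * ε ^ s * r j ω ≤ 1 := by
  apply HasThreshold.of_tsum_ne_top
  set b : ℝ := (1 / 2 : ℝ) ^ s with hb
  have hb0 : 0 < b := by positivity
  have hb2 : b < 1 / 2 := by
    conv_rhs => rw [← Real.rpow_one (1 / 2 : ℝ)]
    exact Real.rpow_lt_rpow_of_exponent_gt (by norm_num) (by norm_num) hs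
  have hq : (2 * b) ^ 3 < 1 := pow_lt_one₀ (by positivity) (by linarith) (by norm_num)
  set M : ENNReal := ∫⁻ ω, ENNReal.ofReal (r 0 ω ^ 3) ∂μ
  have hM : M ≠ ⊤ := hr3.lintegral_lt_top.ne
  have hmarkov : ∀ t : ℝ, 0 < t → μ {ω | t < r 0 ω} ≤ M * ENNReal.ofReal ((t⁻¹) ^ 3) := by
    intro t ht
    have h1 := mul_meas_ge_le_lintegral
      ((h.measurable_mark 0).pow_const 3).ennreal_ofReal (μ := μ) (ENNReal.ofReal (t ^ 3))
    rw [inv_pow, ENNReal.ofReal_inv_of_pos (by positivity), ← div_eq_mul_inv,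
      ENNReal.le_div_iff_mul_le (Or.inl (ENNReal.ofReal_pos.2 (by positivity)).ne') (Or.inl ENNReal.ofReal_ne_top),
      mul_comm]
    refine le_trans ?_ h1
    gcongr
    intro hω
    exact ENNReal.ofReal_le_ofReal (pow_le_pow_left₀ ht.le (le_of_lt hω) 3)
  have hfin : ∑' k : ℕ, ENNReal.ofReal (lam * (4 * R) ^ 3 * τ ^ 3 * ((2 * b) ^ 3) ^ k) * M ≠ ⊤ := by
    rw [ENNReal.tsum_mul_right]
    exact ENNReal.mul_ne_top
      (ENNReal.tsum_ofReal_geometric_ne_top (by positivity) (by positivity) hq) hM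
  refine ne_top_of_le_ne_top hfin (ENNReal.tsum_le_tsum fun k => ?_)
  have hv := volume_cube_abs_le (ρ := R * 2 ^ (k + 1)) (by positivity)
  set S : Set E3 := {x : E3 | ∀ i, |x i| ≤ R * 2 ^ (k + 1)}
  -- The smallest mark threshold over the dyadic range, attained at `ε = 2⁻ᵏ`.
  set t : ℝ := (τ * b ^ k)⁻¹
  have ht : 0 < t := by positivity
  have hsub : {ω | ∃ ε : ℝ, (1 / 2 : ℝ) ^ (k + 1) < ε ∧ ε ≤ (1 / 2 : ℝ) ^ k ∧
      ¬ ∀ j, (∀ i, |z j ω i| ≤ R / ε) → τ * ε ^ s * r j ω ≤ 1} ⊆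
      ⋃ j, (z j ⁻¹' S ∩ r j ⁻¹' Set.Ioi t) := by
    rintro ω ⟨ε, hε1, hε2, hQ⟩
    have hε : 0 < ε := lt_trans (by positivity) hε1
    push Not at hQ
    obtain ⟨j, hj, hrj⟩ := hQ
    refine Set.mem_iUnion.2 ⟨j, fun i => (hj i).trans ?_, ?_⟩
    · rw [div_eq_mul_inv]
      gcongr
      rw [inv_le_comm₀ hε (by positivity), ← inv_pow]
      norm_num at hε1 ⊢
      exact hε1.le
    · have hr0 : 0 < r j ω := by
        by_contra hcon
        have : τ * ε ^ s * r j ω ≤ 0 :=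
          mul_nonpos_of_nonneg_of_nonpos (by positivity) (not_lt.1 hcon)
        linarith
      change (τ * b ^ k)⁻¹ < r j ω
      rw [inv_lt_iff_one_lt_mul₀' (by positivity)]
      refine hrj.trans_le ?_
      rw [hb, ← rpow_half_mul_natCast]
      gcongr
  have hprod : ∀ j, μ (z j ⁻¹' S ∩ r j ⁻¹' Set.Ioi t) = μ {ω | z j ω ∈ S} * μ {ω | t < r 0 ω} := by
    intro j
    have hind : IndepFun (z j) (r j) μ :=
      h.indep_points_marks.comp (measurable_pi_apply j) (measurable_pi_apply j)
    rw [hind.measure_inter_preimage_eq_mul _ _ hv.1 measurableSet_Ioi]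
    congr 1
    exact (h.mark_identDistrib j).measure_mem_eq measurableSet_Ioi
  refine (measure_mono hsub).trans ((measure_iUnion_le _).trans ?_)
  simp_rw [hprod]
  rw [ENNReal.tsum_mul_right]
  have hmean := h.points.tsum_measure_mem_le hlam hv.1 (by rw [hv.2]; exact ENNReal.ofReal_ne_top)
  rw [Measure.real, hv.2, ENNReal.toReal_ofReal (by positivity)] at hmean
  refine (mul_le_mul' hmean (hmarkov t ht)).trans (le_of_eq ?_)
  rw [mul_comm M, ← mul_assoc, ← ENNReal.ofReal_mul (by positivity)]
  congr 2
  simp only [t, inv_inv]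
  rw [pow_right_comm (2 * b) 3 k, mul_pow 2 b k]
  ring

/-! ### Merging points into separated clusters and boxes. -/

/-- A partition of `P` into clusters of at most `N` points, whose spread is controlled by their
cardinality. -/
structure IsClustering (P : Finset E3) (h : ℝ) (N : ℕ) (C : Finset (Finset E3)) : Prop where
  subset : ∀ c ∈ C, c ⊆ P
  nonempty : ∀ c ∈ C, c.Nonempty
  cover : ∀ p ∈ P, ∃ c ∈ C, p ∈ c
  disjoint : ∀ c ∈ C, ∀ d ∈ C, c ≠ d → Disjoint c d
  card_le : ∀ c ∈ C, c.card ≤ N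
  spread : ∀ c ∈ C, ∀ p ∈ c, ∀ q ∈ c, ∀ i, p i - q i ≤ 3 * (c.card - 1) * h

/-- In one of the coordinates, `c` lies at least `3 h` below `d`, or conversely. -/
def ClusterSeparated (h : ℝ) (c d : Finset E3) : Prop :=
  ∃ i, (∀ p ∈ c, ∀ q ∈ d, p i + 3 * h ≤ q i) ∨ (∀ p ∈ c, ∀ q ∈ d, q i + 3 * h ≤ p i)

namespace IsClustering

variable {P : Finset E3} {h : ℝ} {N : ℕ}

theorem singletons [DecidableEq E3] (hN : 1 ≤ N) :
    IsClustering P h N (P.image fun p => {p}) where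
  subset := by simp
  nonempty := by simp
  cover := by simp
  disjoint := by
    simp only [Finset.mem_image]
    rintro _ ⟨p, -, rfl⟩ _ ⟨q, -, rfl⟩ hne
    rw [Finset.disjoint_singleton]
    rintro rfl
    exact hne rfl
  card_le := by simpa using fun _ _ => hN
  spread := by
    simp only [Finset.mem_image]
    rintro _ ⟨p, -, rfl⟩ a ha b hb i
    rw [Finset.mem_singleton] at ha hb
    simp [ha, hb]

/-- Without separation, in each coordinate some pair across `c` and `d` has gap below `3h` in either
direction, so the spreads add up: `3(|c| - 1)h + 3h + 3(|d| - 1)h = 3(|c ∪ d| - 1)h`. As this is at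
most `6Nh`, `hP` restores the bound `N` on the cardinality. -/
theorem merge [DecidableEq E3] (hh : 0 ≤ h)
    (hP : ∀ A ⊆ P, (∀ p ∈ A, ∀ q ∈ A, ∀ i, |p i - q i| ≤ 6 * N * h) → A.card ≤ N)
    {C : Finset (Finset E3)} (hC : IsClustering P h N C) {c d : Finset E3} (hc : c ∈ C)
    (hd : d ∈ C) (hcd : c ≠ d) (hsep : ¬ ClusterSeparated h c d) :
    IsClustering P h N (insert (c ∪ d) ((C.erase c).erase d)) := by
  have hmem : ∀ e ∈ insert (c ∪ d) ((C.erase c).erase d), e = c ∪ d ∨ (e ∈ C ∧ e ≠ c ∧ e ≠ d) := by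
    intro e he
    simp only [Finset.mem_insert, Finset.mem_erase] at he
    tauto
  have hcard : ((c ∪ d).card : ℝ) = c.card + d.card := by
    exact_mod_cast Finset.card_union_of_disjoint (hC.disjoint c hc d hd hcd)
  have hc1 : (1 : ℝ) ≤ c.card := by exact_mod_cast (hC.nonempty c hc).card_pos
  have hd1 : (1 : ℝ) ≤ d.card := by exact_mod_cast (hC.nonempty d hd).card_pos
  have hcN : (c.card : ℝ) ≤ N := by exact_mod_cast hC.card_le c hc
  have hdN : (d.card : ℝ) ≤ N := by exact_mod_cast hC.card_le d hd
  have hspread : ∀ p ∈ c ∪ d, ∀ q ∈ c ∪ d, ∀ i, p i - q i ≤ 3 * ((c ∪ d).card - 1) * h := by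
    intro p hp q hq i
    rw [hcard]
    unfold ClusterSeparated at hsep
    push Not at hsep
    obtain ⟨⟨u, hu, v, hv, huv⟩, ⟨u', hu', v', hv', huv'⟩⟩ := hsep i
    have hch : 0 ≤ (c.card - 1 : ℝ) * h := mul_nonneg (by linarith) hh
    have hdh : 0 ≤ (d.card - 1 : ℝ) * h := mul_nonneg (by linarith) hh
    rcases Finset.mem_union.1 hp with hp | hp <;> rcases Finset.mem_union.1 hq with hq | hq
    · linarith [hC.spread c hc p hp q hq i]
    · linarith [hC.spread c hc p hp u' hu' i, hC.spread d hd v' hv' q hq i]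
    · linarith [hC.spread d hd p hp v hv i, hC.spread c hc u hu q hq i]
    · linarith [hC.spread d hd p hp q hq i]
  have hsub : c ∪ d ⊆ P := Finset.union_subset (hC.subset c hc) (hC.subset d hd)
  refine ⟨?_, ?_, ?_, ?_, ?_, ?_⟩
  · intro e he
    rcases hmem e he with rfl | he
    exacts [hsub, hC.subset e he.1]
  · intro e he
    rcases hmem e he with rfl | he
    exacts [(hC.nonempty c hc).mono Finset.subset_union_left, hC.nonempty e he.1]
  · intro p hp
    obtain ⟨e, he, hpe⟩ := hC.cover p hp
    by_cases h1 : e = c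
    · exact ⟨c ∪ d, Finset.mem_insert_self _ _, Finset.mem_union_left _ (h1 ▸ hpe)⟩
    by_cases h2 : e = d
    · exact ⟨c ∪ d, Finset.mem_insert_self _ _, Finset.mem_union_right _ (h2 ▸ hpe)⟩
    exact ⟨e, by simp [h1, h2, he], hpe⟩
  · intro e he f hf hef
    rcases hmem e he with rfl | he <;> rcases hmem f hf with rfl | hf
    · exact absurd rfl hef
    · exact Finset.disjoint_union_left.2 ⟨hC.disjoint c hc f hf.1 hf.2.1.symm,
        hC.disjoint d hd f hf.1 hf.2.2.symm⟩
    · exact Finset.disjoint_union_right.2 ⟨hC.disjoint e he.1 c hc he.2.1,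
        hC.disjoint e he.1 d hd he.2.2⟩
    · exact hC.disjoint e he.1 f hf.1 hef
  · intro e he
    rcases hmem e he with rfl | he
    · refine hP _ hsub fun p hp q hq i => ?_
      have hle : 3 * ((c ∪ d).card - 1 : ℝ) * h ≤ 6 * N * h := by
        rw [hcard]
        refine mul_le_mul_of_nonneg_right ?_ hh
        linarith
      rw [abs_sub_le_iff]
      exact ⟨(hspread p hp q hq i).trans hle, (hspread q hq p hp i).trans hle⟩
    · exact hC.card_le e he.1
  · intro e he
    rcases hmem e he with rfl | he
    exacts [hspread, hC.spread e he.1]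

/-- Repeated merging yields a clustering with pairwise separated clusters. -/
theorem exists_separated (hh : 0 ≤ h) (hN : 1 ≤ N)
    (hP : ∀ A ⊆ P, (∀ p ∈ A, ∀ q ∈ A, ∀ i, |p i - q i| ≤ 6 * N * h) → A.card ≤ N) :
    ∃ C, IsClustering P h N C ∧ ∀ c ∈ C, ∀ d ∈ C, c ≠ d → ClusterSeparated h c d := by
  classical
  suffices H : ∀ n : ℕ, ∀ C : Finset (Finset E3), C.card = n → IsClustering P h N C →
      ∃ C, IsClustering P h N C ∧ ∀ c ∈ C, ∀ d ∈ C, c ≠ d → ClusterSeparated h c d from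
    H _ _ rfl (singletons hN)
  intro n
  induction n using Nat.strong_induction_on with
  | _ n ih =>
    intro C hn hC
    by_cases hsep : ∀ c ∈ C, ∀ d ∈ C, c ≠ d → ClusterSeparated h c d
    · exact ⟨C, hC, hsep⟩
    push Not at hsep
    obtain ⟨c, hc, d, hd, hcd, hs⟩ := hsep
    refine ih _ ?_ _ rfl (hC.merge hh hP hc hd hcd hs)
    have h1 := Finset.card_insert_le (c ∪ d) ((C.erase c).erase d)
    have hd' : d ∈ C.erase c := Finset.mem_erase.2 ⟨hcd.symm, hd⟩
    have h2 := Finset.card_erase_add_one hd'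
    have h3 := Finset.card_erase_add_one hc
    omega

end IsClustering

theorem abs_sub_le_distSup (x y : E3) (i : Fin 3) : |x i - y i| ≤ distSup x y := by
  rw [← Real.dist_eq]
  exact dist_le_pi_dist (WithLp.ofLp x) (WithLp.ofLp y) i

/-- Finitely many points without large clusters can be enclosed in well-separated boxes
containing few points each, all points having distance at least `h` to the faces of their box. -/
theorem exists_separated_boxes {P : Finset E3} {h : ℝ} {N : ℕ} (hh : 0 < h) (hN : 1 ≤ N)
    (hP : ∀ A ⊆ P, (∀ p ∈ A, ∀ q ∈ A, ∀ i, |p i - q i| ≤ 6 * N * h) → A.card ≤ N) :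
    ∃ (n : ℕ) (a b : Fin n → Fin 3 → ℝ),
      (∀ i, ∃ p ∈ P, p ∈ openBox (a i) (b i)) ∧
      (∀ p ∈ P, ∃ i, p ∈ openBox (a i) (b i)) ∧
      (∀ i, ∀ p ∈ P, p ∈ openBox (a i) (b i) → ∀ k, a i k + h ≤ p k ∧ p k + h ≤ b i k) ∧
      (∀ i, {x | x ∈ openBox (a i) (b i) ∧ x ∈ P}.encard ≤ N) ∧
      (∀ i j, i ≠ j → ∀ x ∈ openBox (a i) (b i), ∀ y ∈ openBox (a j) (b j), h ≤ distSup x y) ∧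
      (∀ i k, 2 * h ≤ b i k - a i k ∧ b i k - a i k ≤ 4 * N * h) := by
  obtain ⟨C, hC, hsep⟩ := IsClustering.exists_separated hh.le hN hP
  let e := C.equivFin.symm
  have hne : ∀ i, (e i).1.Nonempty := fun i => hC.nonempty _ (e i).2
  let a : Fin C.card → Fin 3 → ℝ := fun i k => (e i).1.inf' (hne i) (fun p => p k) - h
  let b : Fin C.card → Fin 3 → ℝ := fun i k => (e i).1.sup' (hne i) (fun p => p k) + h
  have hin : ∀ i, ∀ p ∈ (e i).1, ∀ k, a i k + h ≤ p k ∧ p k + h ≤ b i k := by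
    intro i p hp k
    have h1 := Finset.inf'_le (fun p : E3 => p k) hp
    have h2 := Finset.le_sup' (fun p : E3 => p k) hp
    constructor
    · rwa [sub_add_cancel]
    · exact add_le_add_left h2 h
  have hbox : ∀ i, ∀ p ∈ (e i).1, p ∈ openBox (a i) (b i) := by
    intro i p hp k
    have := hin i p hp k
    constructor <;> linarith
  have ha : ∀ i k, ∃ p ∈ (e i).1, a i k = p k - h := by
    intro i k
    obtain ⟨p, hp, hpk⟩ := Finset.exists_mem_eq_inf' (hne i) (fun p : E3 => p k)
    exact ⟨p, hp, by simp only [a, hpk]⟩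
  have hb : ∀ i k, ∃ p ∈ (e i).1, b i k = p k + h := by
    intro i k
    obtain ⟨p, hp, hpk⟩ := Finset.exists_mem_eq_sup' (hne i) (fun p : E3 => p k)
    exact ⟨p, hp, by simp only [b, hpk]⟩
  -- Of the gap `3h` between clusters, the two enlargements use `2h`.
  have hS : ∀ i j, i ≠ j → ∀ x ∈ openBox (a i) (b i), ∀ y ∈ openBox (a j) (b j),
      h ≤ distSup x y := by
    intro i j hij x hx y hy
    have hne' : (e i).1 ≠ (e j).1 := fun hcon => hij (e.injective (Subtype.ext hcon))
    obtain ⟨k, hk⟩ := hsep _ (e i).2 _ (e j).2 hne'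
    refine le_trans ?_ (abs_sub_le_distSup x y k)
    have hxk := hx k
    have hyk := hy k
    rcases hk with hk | hk
    · obtain ⟨p, hp, hpb⟩ := hb i k
      obtain ⟨q, hq, hqa⟩ := ha j k
      have := hk p hp q hq
      rw [le_abs]
      right
      linarith
    · obtain ⟨p, hp, hpa⟩ := ha i k
      obtain ⟨q, hq, hqb⟩ := hb j k
      have := hk p hp q hq
      rw [le_abs]
      left
      linarith
  have hcov : ∀ p ∈ P, ∃ i, p ∈ (e i).1 := by
    intro p hp
    obtain ⟨c, hc, hpc⟩ := hC.cover p hp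
    exact ⟨e.symm ⟨c, hc⟩, by simpa using hpc⟩
  -- A point of another cluster would lie in two boxes at positive distance.
  have hown : ∀ i, ∀ p ∈ P, p ∈ openBox (a i) (b i) → p ∈ (e i).1 := by
    intro i p hp hpi
    obtain ⟨j, hj⟩ := hcov p hp
    by_contra hcon
    have hij : i ≠ j := by
      rintro rfl
      exact hcon hj
    have := hS i j hij p hpi p (hbox j p hj)
    simp only [distSup, dist_self] at this
    linarith
  refine ⟨C.card, a, b, fun i => ?_, fun p hp => ?_, fun i p hp hpi => hin i p (hown i p hp hpi),
    fun i => ?_, hS, fun i k => ?_⟩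
  · obtain ⟨p, hp⟩ := hne i
    exact ⟨p, hC.subset _ (e i).2 hp, hbox i p hp⟩
  · obtain ⟨i, hi⟩ := hcov p hp
    exact ⟨i, hbox i p hi⟩
  · refine (Set.encard_le_encard (t := ((e i).1 : Set E3)) fun x hx => hown i x hx.2 hx.1).trans ?_
    rw [Set.encard_coe_eq_coe_finsetCard]
    exact_mod_cast hC.card_le _ (e i).2
  · constructor
    · obtain ⟨p, hp⟩ := hne i
      have := hin i p hp k
      linarith
    · obtain ⟨p, hp, hpa⟩ := ha i k
      obtain ⟨q, hq, hqb⟩ := hb i k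
      have h1 := hC.spread _ (e i).2 q hq p hp k
      have h2 : (((e i).1.card : ℝ)) ≤ N := by exact_mod_cast hC.card_le _ (e i).2
      have h3 : ((e i).1.card : ℝ) * h ≤ N * h := by gcongr
      have h4 : 0 ≤ N * h := by positivity
      linarith

/-! ### Geometry of boxes and balls at a fixed scale. -/

theorem abs_apply_le_norm (x : E3) (i : Fin 3) : |x i| ≤ ‖x‖ := by
  simpa using PiLp.norm_apply_le x i

theorem abs_sub_apply_le_dist (x y : E3) (i : Fin 3) : |x i - y i| ≤ dist x y := by
  rw [dist_eq_norm]
  exact abs_apply_le_norm (x - y) i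

theorem dist_le_two_mul_of_abs_sub_le {x y : E3} {L : ℝ} (hL : 0 ≤ L)
    (h : ∀ i, |x i - y i| ≤ L) : dist x y ≤ 2 * L := by
  rw [EuclideanSpace.dist_eq]
  refine Real.sqrt_le_iff.2 ⟨by positivity, ?_⟩
  have hi : ∀ i, dist (x i) (y i) ^ 2 ≤ L ^ 2 := fun i => by
    rw [Real.dist_eq]
    exact pow_le_pow_left₀ (abs_nonneg _) (h i) 2
  rw [Fin.sum_univ_three]
  nlinarith [hi 0, hi 1, hi 2, sq_nonneg L]

theorem isOpen_openBox (a b : Fin 3 → ℝ) : IsOpen (openBox a b) := by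
  have : openBox a b = ⋂ i, {x : E3 | a i < x i ∧ x i < b i} := by
    ext x
    simp [openBox]
  rw [this]
  refine isOpen_iInter_of_finite fun i => ?_
  have hc : Continuous fun x : E3 => x i := by fun_prop
  exact (isOpen_lt continuous_const hc).inter (isOpen_lt hc continuous_const)

/-- A point with distance at least `h` to the faces of a box has distance at least `h` to its
boundary. -/
theorem le_dist_of_mem_frontier_openBox {a b : Fin 3 → ℝ} {h : ℝ} {p y : E3}
    (hp : ∀ k, a k + h ≤ p k ∧ p k + h ≤ b k) (hy : y ∈ frontier (openBox a b)) : h ≤ dist p y := by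
  have hy' : y ∉ openBox a b := fun hcon =>
    (isOpen_openBox a b).inter_frontier_eq.subset ⟨hcon, hy⟩
  by_contra! hlt
  refine hy' fun k => ?_
  have h1 := abs_lt.1 ((abs_sub_apply_le_dist p y k).trans_lt hlt)
  have := hp k
  constructor <;> linarith

/-- A ball of radius smaller than the distance of its centre `p ∈ D` to `∂D` is contained in
`D`. -/
theorem closedBall_subset_of_lt_infDist_frontier {D : Set E3} {p : E3} {ε : ℝ} (hp : p ∈ D)
    (hε : ε < Metric.infDist p (frontier D)) : Metric.closedBall p ε ⊆ D := by
  intro x hx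
  have hε0 : 0 ≤ ε := dist_nonneg.trans hx
  have hconn : IsPreconnected (Metric.closedBall p ε) := (convex_closedBall p ε).isPreconnected
  by_contra hxD
  obtain ⟨y, hy, hyD⟩ := isPreconnected_closed_iff.1 hconn (closure D) (closure Dᶜ)
    isClosed_closure isClosed_closure
    (fun w _ => (em (w ∈ D)).imp (fun h => subset_closure h) fun h => subset_closure h)
    ⟨p, Metric.mem_closedBall_self hε0, subset_closure hp⟩ ⟨x, hx, subset_closure hxD⟩
  rw [← frontier_eq_closure_inter_closure] at hyD
  have h1 := Metric.infDist_le_dist_of_mem (x := p) hyD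
  rw [Metric.mem_closedBall, dist_comm] at hy
  linarith

theorem eventually_rpow_le {y c : ℝ} (hy : 0 < y) (hc : 0 < c) :
    ∀ᶠ ε : ℝ in nhdsWithin 0 (Set.Ioi 0), ε ^ y ≤ c := by
  have h := (Real.continuousAt_rpow_const 0 y (Or.inr hy.le)).tendsto
  rw [Real.zero_rpow hy.ne'] at h
  exact (h.mono_left nhdsWithin_le_nhds).eventually_le_const hc

theorem setOf_mem_and_eq_smul {T B : Set E3} {ε : ℝ} (P : Finset E3)
    (hP : ∀ x, x ∈ P ↔ ∃ p ∈ T, x = ε • p) :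
    {x : E3 | x ∈ B ∧ ∃ p ∈ T, x = ε • p} = {x | x ∈ B ∧ x ∈ P} := by
  ext x
  exact and_congr_right fun _ => (hP x).symm

/-- The boxes around the rescaled points, at a fixed scale `ε` at which no large clusters occur. -/
theorem exists_boxes_of_cluster_bound {D T : Set E3} {ε δ κ : ℝ} {N : ℕ} (hN : 1 ≤ N) (hε : 0 < ε)
    (hTfin : T.Finite) (hTD : ∀ p ∈ T, ε • p ∈ D ∧ ε < Metric.infDist (ε • p) (frontier D))
    (hcl : ∀ A ⊆ T, (∀ p ∈ A, ∀ q ∈ A, ∀ i, |p i - q i| ≤ 3 / 2 * ε ^ δ) → A.encard ≤ N)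
    (hκ : ε ^ (κ - δ) ≤ 3 / (16 * N)) (hδ : ε ^ δ ≤ 1 / 2) :
    ∃ (n : ℕ) (a b : Fin n → Fin 3 → ℝ),
      (∀ i, openBox (a i) (b i) ⊆ D) ∧
      (∀ p ∈ T, Metric.closedBall (ε • p) (ε ^ (1 + κ)) ⊆ ⋃ i, openBox (a i) (b i)) ∧
      (∀ i, {x : E3 | x ∈ openBox (a i) (b i) ∧ ∃ p ∈ T, x = ε • p}.encard ≤ N) ∧
      (∀ i, ∀ p ∈ T, ε • p ∈ openBox (a i) (b i) →
        ∀ x ∈ Metric.closedBall (ε • p) (ε ^ (1 + κ)), ∀ y ∈ frontier (openBox (a i) (b i)),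
          1 / (16 * N) * ε ^ (1 + δ) ≤ dist x y) ∧
      (∀ i j, i ≠ j → ∀ x ∈ openBox (a i) (b i), ∀ y ∈ openBox (a j) (b j),
        1 / (4 * N) * ε ^ (1 + δ) ≤ distSup x y) ∧
      (∀ i k, 1 / (2 * N) * ε ^ (1 + δ) ≤ b i k - a i k ∧ b i k - a i k ≤ ε ^ (1 + δ)) := by
  classical
  have hN0 : (0 : ℝ) < N := by exact_mod_cast hN
  set L : ℝ := ε ^ (1 + δ) with hL
  have hL0 : 0 < L := by positivity
  have hLε : L = ε * ε ^ δ := by rw [hL, Real.rpow_add hε, Real.rpow_one]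
  -- This makes the maximal side `4Nh` equal to `L`, and the cluster diameter `6Nh` equal to `ε ·
  -- (3/2) ε^δ`, as `hcl` requires.
  set h : ℝ := 1 / (4 * N) * L with hh
  have hh0 : 0 < h := by positivity
  have hNh : 4 * N * h = L := by rw [hh]; field_simp
  -- Of the margin `h` around each point, `h / 4 = L / (16N)` remains outside the ball.
  have hrad : ε ^ (1 + κ) ≤ 3 / 4 * h := by
    have e1 : ε ^ (1 + κ) = L * ε ^ (κ - δ) := by
      rw [hL, ← Real.rpow_add hε]
      congr 1
      ring
    have e2 : 3 / 4 * h = L * (3 / (16 * N)) := by rw [hh]; field_simp; ring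
    rw [e1, e2]
    gcongr
  set P : Finset E3 := hTfin.toFinset.image fun p => ε • p with hPdef
  have hPmem : ∀ x, x ∈ P ↔ ∃ p ∈ T, x = ε • p := by
    intro x
    simp only [hPdef, Finset.mem_image, Set.Finite.mem_toFinset, eq_comm]
  have hPcl : ∀ A ⊆ P, (∀ p ∈ A, ∀ q ∈ A, ∀ i, |p i - q i| ≤ 6 * N * h) → A.card ≤ N := by
    intro A hA hAs
    have hinj : Function.Injective fun p : E3 => ε • p := smul_right_injective E3 hε.ne'
    have himg : (A : Set E3) = (fun p : E3 => ε • p) '' {p | p ∈ T ∧ ε • p ∈ A} := by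
      ext x
      constructor
      · intro hx
        obtain ⟨p, hp, rfl⟩ := (hPmem x).1 (hA hx)
        exact ⟨p, ⟨hp, hx⟩, rfl⟩
      · rintro ⟨p, hp, rfl⟩
        exact hp.2
    have hle := hcl {p | p ∈ T ∧ ε • p ∈ A} (fun p hp => hp.1) (by
      intro p hp q hq i
      have h1 := hAs _ hp.2 _ hq.2 i
      simp only [PiLp.smul_apply, smul_eq_mul, ← mul_sub, abs_mul, abs_of_pos hε] at h1
      have h2 : 6 * N * h = ε * (3 / 2 * ε ^ δ) := by linarith
      rw [h2] at h1
      exact le_of_mul_le_mul_left h1 hε)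
    rw [← hinj.encard_image, ← himg, Set.encard_coe_eq_coe_finsetCard] at hle
    exact_mod_cast hle
  obtain ⟨n, a, b, hne, hcov, hmargin, hcount, hsep, hside⟩ := exists_separated_boxes hh0 hN hPcl
  have hin : ∀ p ∈ T, ε • p ∈ P := fun p hp => (hPmem _).2 ⟨p, hp, rfl⟩
  refine ⟨n, a, b, fun i x hx => ?_, fun p hp x hx => ?_, fun i => ?_, fun i p hp hpi x hx y hy => ?_,
    hsep, fun i k => ⟨?_, (hside i k).2.trans hNh.le⟩⟩
  · obtain ⟨q, hq, hqi⟩ := hne i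
    obtain ⟨p, hp, rfl⟩ := (hPmem q).1 hq
    refine closedBall_subset_of_lt_infDist_frontier (hTD p hp).1 (hTD p hp).2 ?_
    rw [Metric.mem_closedBall]
    refine (dist_le_two_mul_of_abs_sub_le hL0.le fun k => ?_).trans ?_
    · have h1 := hx k
      have h2 := hqi k
      have h3 := (hside i k).2
      rw [hNh] at h3
      rw [abs_sub_le_iff]
      constructor <;> linarith
    -- `2L = 2 ε ε^δ ≤ ε`, so the box lies in the ball of radius `ε` about one of its points.
    · rw [hLε]
      nlinarith
  · obtain ⟨i, hi⟩ := hcov _ (hin p hp)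
    refine Set.mem_iUnion.2 ⟨i, fun k => ?_⟩
    have h1 := hmargin i _ (hin p hp) hi k
    have h2 := abs_le.1 ((abs_sub_apply_le_dist x (ε • p) k).trans (Metric.mem_closedBall.1 hx))
    constructor <;> linarith
  · rw [setOf_mem_and_eq_smul P hPmem]
    exact hcount i
  · have h1 := le_dist_of_mem_frontier_openBox (hmargin i _ (hin p hp) hpi) hy
    have h2 := Metric.mem_closedBall.1 hx
    have h3 := dist_triangle_left (ε • p) y x
    have h4 : 1 / (16 * N) * L = 1 / 4 * h := by rw [hh]; field_simp; ring
    rw [h4]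
    linarith
  · refine le_trans (le_of_eq ?_) (hside i k).1
    rw [hh]
    field_simp
    ring

/-! ### Choice of exponents and conclusion. -/

theorem one_le_clusterBound (δ : ℝ) : 1 ≤ clusterBound δ := by
  unfold clusterBound
  omega

theorem one_lt_mul_clusterBound {δ : ℝ} (hδ : 0 < δ) : 1 < δ * clusterBound δ := by
  have h1 : 1 / δ ≤ ⌈1 / δ⌉₊ := Nat.le_ceil _
  rw [div_le_iff₀ hδ] at h1
  unfold clusterBound
  push_cast
  nlinarith

theorem theorem3p1 {Ω : Type*} [MeasurableSpace Ω] (μ : Measure Ω) [IsProbabilityMeasure μ]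
    (D : Set E3) (hD_open : IsOpen D) (hD_bounded : Bornology.IsBounded D)
    (hD_star : StarConvex ℝ 0 D)
    (lam : ℝ) (hlam : 0 < lam) (z : ℕ → Ω → E3) (r : ℕ → Ω → ℝ)
    (hzr : IsMarkedPoissonPointProcess μ lam z r)
    (hr3 : Integrable (fun ω => r 0 ω ^ 3) μ)
    (α δ κ τ : ℝ) (hα : 3 < α) (hδ : δ = (α - 3) / 3)
    (hκ : κ ∈ Set.Ioo (max 1 δ) (α - 2)) (hτ : 1 ≤ τ) :
    ∃ ε₀ : Ω → ℝ, Measurable ε₀ ∧ (∀ᵐ ω ∂μ, 0 < ε₀ ω) ∧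
      ∀ ω, ∀ ε : ℝ, 0 < ε → ε ≤ ε₀ ω →
        -- the radii are small
        (∀ j, z j ω ∈ innerPoints (pointSet z ω) D ε → τ * ε ^ α * r j ω ≤ ε ^ (1 + κ)) ∧
        -- the enlarged balls are pairwise disjoint
        (∀ p ∈ innerPoints (pointSet z ω) D ε, ∀ q ∈ innerPoints (pointSet z ω) D ε, p ≠ q →
          Disjoint (Metric.closedBall (ε • p) (τ * ε ^ (1 + κ)))
            (Metric.closedBall (ε • q) (τ * ε ^ (1 + κ)))) ∧
        -- there are finitely many open boxes contained in `D` such that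
        ∃ (n : ℕ) (a b : Fin n → Fin 3 → ℝ),
          (∀ i, openBox (a i) (b i) ⊆ D) ∧
          -- the boxes cover the balls
          (∀ p ∈ innerPoints (pointSet z ω) D ε,
            Metric.closedBall (ε • p) (ε ^ (1 + κ)) ⊆ ⋃ i, openBox (a i) (b i)) ∧
          -- each box contains at most `N` of the rescaled points
          (∀ i, {x : E3 | x ∈ openBox (a i) (b i) ∧
              ∃ p ∈ innerPoints (pointSet z ω) D ε, x = ε • p}.encard ≤ clusterBound δ) ∧
          -- the balls are well inside the boxes
          (∀ i, ∀ p ∈ innerPoints (pointSet z ω) D ε, ε • p ∈ openBox (a i) (b i) →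
            ∀ x ∈ Metric.closedBall (ε • p) (ε ^ (1 + κ)),
            ∀ y ∈ frontier (openBox (a i) (b i)),
              1 / (16 * clusterBound δ) * ε ^ (1 + δ) ≤ dist x y) ∧
          -- distinct boxes are well separated in the maximum norm
          (∀ i j, i ≠ j → ∀ x ∈ openBox (a i) (b i), ∀ y ∈ openBox (a j) (b j),
            1 / (4 * clusterBound δ) * ε ^ (1 + δ) ≤ distSup x y) ∧
          -- the side lengths are comparable to `ε ^ (1 + δ)`
          (∀ i k, 1 / (2 * clusterBound δ) * ε ^ (1 + δ) ≤ b i k - a i k ∧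
            b i k - a i k ≤ ε ^ (1 + δ)) := by
  have hδ0 : 0 < δ := by rw [hδ]; linarith
  obtain ⟨hκ1, hκ2⟩ := hκ
  have hκ1' : 1 < κ := (le_max_left _ _).trans_lt hκ1
  have hκδ : δ < κ := (le_max_right _ _).trans_lt hκ1
  have hτ0 : 0 < τ := by linarith
  have hN0 : (0 : ℝ) < clusterBound δ := by exact_mod_cast one_le_clusterBound δ
  obtain ⟨R, hR0, hR⟩ := hD_bounded.exists_pos_norm_le
  have hmarks := hzr.hasThreshold_marks hlam hr3 hR0.le hτ0 (s := α - 1 - κ) (by linarith)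
  have hfinite := hzr.points.hasThreshold_finite hlam hR0.le
  -- Intersecting balls of radius `τ ε^(1+κ)` put two points of `Φ` within `2τ ε^κ`; with `n = 1`
  -- the condition `γ n > 1` is `κ > 1`.
  have hpairs := hzr.points.hasThreshold_cluster hlam R (c := 2 * τ) (γ := κ) (n := 1)
    (by positivity) (by linarith) (by simpa using hκ1')
  have hclusters := hzr.points.hasThreshold_cluster hlam R (c := 3 / 2) (by norm_num) hδ0
    (one_lt_mul_clusterBound hδ0)
  have hsmall : HasThreshold μ fun _ ε =>
      ε ^ (κ - δ) ≤ 3 / (16 * clusterBound δ : ℝ) ∧ ε ^ δ ≤ 1 / 2 :=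
    .of_eventually ((eventually_rpow_le (by linarith) (by positivity)).and
      (eventually_rpow_le hδ0 (by norm_num)))
  refine ((((hmarks.and hfinite).and hpairs).and hclusters).and hsmall).mono ?_
  rintro ω ε hε ⟨⟨⟨⟨hmark, hfin⟩, hpair⟩, hcl⟩, hs1, hs2⟩
  have hbd : ∀ p ∈ innerPoints (pointSet z ω) D ε, ∀ i, |p i| ≤ R / ε := by
    intro p hp i
    refine (abs_apply_le_norm p i).trans ?_
    have h1 := hR _ hp.2.1
    rw [norm_smul, Real.norm_of_nonneg hε.le] at h1
    rwa [le_div_iff₀ hε, mul_comm]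
  refine ⟨fun j hj => ?_, fun p hp q hq hpq => ?_, ?_⟩
  · have h1 := hmark j (hbd _ hj)
    have h2 : ε ^ α = ε ^ (α - 1 - κ) * ε ^ (1 + κ) := by
      rw [← Real.rpow_add hε]
      congr 1
      ring
    calc τ * ε ^ α * r j ω = τ * ε ^ (α - 1 - κ) * r j ω * ε ^ (1 + κ) := by rw [h2]; ring
      _ ≤ 1 * ε ^ (1 + κ) := by gcongr
      _ = ε ^ (1 + κ) := one_mul _
  · rw [Set.disjoint_left]
    intro x hxp hxq
    have hd : dist (ε • p) (ε • q) ≤ 2 * (τ * ε ^ (1 + κ)) := by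
      have := dist_triangle_left (ε • p) (ε • q) x
      have h1 := Metric.mem_closedBall.1 hxp
      have h2 := Metric.mem_closedBall.1 hxq
      linarith
    rw [dist_smul₀, Real.norm_of_nonneg hε.le, Real.rpow_add hε, Real.rpow_one] at hd
    have hd' : dist p q ≤ 2 * τ * ε ^ κ := by
      refine le_of_mul_le_mul_left (hd.trans (le_of_eq ?_)) hε
      ring
    have hcard := hpair {p, q} (Set.pair_subset hp.1 hq.1) (by
      rintro x (rfl | rfl)
      exacts [hbd _ hp, hbd _ hq]) (by
      have h0 : 0 ≤ 2 * τ * ε ^ κ := by positivity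
      rintro x (rfl | rfl) y (rfl | rfl) i
      · simpa using h0
      · exact (abs_sub_apply_le_dist _ _ i).trans hd'
      · rw [abs_sub_comm]
        exact (abs_sub_apply_le_dist _ _ i).trans hd'
      · simpa using h0)
    rw [Set.encard_pair hpq] at hcard
    norm_num at hcard
  · exact exists_boxes_of_cluster_bound (one_le_clusterBound δ) hε
      (hfin.subset fun p hp => ⟨hp.1, hbd p hp⟩) (fun p hp => hp.2)
      (fun A hA => hcl A (fun p hp => (hA hp).1) fun p hp => hbd p (hA hp)) hs1 hs2
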